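/- **Setting.** $\Gamma$ is a finite two-player zero-sum extensive-form game with explicit observations between $\oplus$ and $\ominus$: a finite game tree with utility $u(z)$ (paid to $\oplus$) at each leaf $z$; at each internal node either nature, $\oplus$ or $\ominus$ moves; each player $i$ receives an observation at each internal node, which determines whether $i$ is to move there. The sequence $s_i(h)$ is the list of observations made and actions played by $i$ up to $h$ (including her observation at $h$ if $h$ is internal). Infosets of $i$ are the classes of nodes of equal depth with equal $s_i$ (whether or not $i$ moves there); the same actions are available at all nodes of an infoset at which its player moves. $X,Y$ are the sets of sequence-form mixed strategies of $\oplus,\ominus$; $x(h)=x(s_\oplus(h))$, $y(h)=y(s_\ominus(h))$; $p(h)$ is the probability that nature plays her actions on the path to $h$; $u(x,y)=\sum_z u(z)p(z)x(z)y(z)$ and $u^*(x)=\min_{y\in Y}u(x,y)$. A profile $(x,y)$ is an $\varepsilon$-NE if each player plays an $\varepsilon$-best response. A strategy $x\in X$ is an *$\varepsilon$-NE strategy* if its exploitability $\max_{\hat x\in X}u^*(\hat x)-u^*(x)$ is at most $\varepsilon$. We write $h\succeq I$ if $h$ has an ancestor (possibly $h$) in $I$, $\overline I=\{h: h\succeq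 I\}$, and $I\succeq I'$ if nodes of $I$ have an ancestor in $I'$. **The graph $G'$.** Its vertices are the $\oplus$-infosets; two distinct $\oplus$-infosets are adjacent if they contain nodes lying in a common $\ominus$-infoset. **1-KLSS** at a $\oplus$-infoset $I$ with current strategy $x$. Let $\mathcal K$ be the set of $\ominus$-infosets $K$ with $\sum_{h\in K\cap I}p(h)x(h)>0$. For each $K \in \mathcal K$ let $D_K$ be either $\sum_{h\in K\cap I}p(h)x(h)$ or $\sum_{h\in K}p(h)x(h)$ (the same choice for all $K$), and let $u^*(x|K)=\frac1{D_K}\min_{y\in Y:\,y(K)=1}\sum_{z\succeq K}u(z)p(z)x(z)y(z)$. In the gadget game, $\oplus$ chooses a strategy $\tilde x\in X$ that agrees with $x$ outside $\overline I$; in the *maxmargin* gadget $\ominus$ chooses (possibly at random) an infoset $K\in\mathcal K$; in the *resolving* gadget nature chooses $K\in\mathcal K$ uniformly and $\ominus$, observing $K$, either exits, with payoff $0$, or plays on. After that $\ominus$ continues from $K$ with some $y_K\in Y$, $y_K(K)=1$, and the payoff to $\oplus$ is $\frac1{D_K}\sum_{z\succeq K}u(z)p(z)\tilde x(z)y_K(z)-u^*(x|K)$.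 A result of 1-KLSS is any $\tilde x$ that is $\oplus$'s part of a Nash equilibrium of one of these gadget games (if $\mathcal K=\emptyset$, any $\tilde x \in X$ agreeing with $x$ outside $\overline I$). 1-KLSS is *performed at every infoset of* $\mathcal I$, starting from a blueprint $x$, as follows: upon arriving at an infoset $I\in\mathcal I$, 1-KLSS is performed at $I$ with the strategy $\oplus$ is then following (the result of the solve at the last infoset of $\mathcal I$ passed strictly before $I$, or $x$ if there is none), and its result $x_I$ is followed until the next solve. The variant (maxmargin or resolving, and the normalization) may depend on $I$. The resulting strategy $x'\in X$ satisfies $x'(h)=x_I(h)$, where $I$ is the last infoset of $\mathcal I$ with $h\succeq I$, and $x'(h)=x(h)$ if there is none. **Theorem.** Let $x$ be an $\varepsilon$-NE blueprint strategy for $\oplus$. Let $\mathcal I$ be an independent set in $G'$ that is closed under ancestors (if $I\in\mathcal I$ and $I\succeq I'$ then $I'\in\mathcal I$). Suppose that 1-KLSS is performed at every infoset in $\mathcal I$, creating a strategy $x'$. Then $x'$ is also an $\varepsilon$-NE strategy. Moreover, for every $\delta$ and $y\in Y$ such that $(x,y)$ is a $\delta$-NE, $(x',y)$ is a $2\delta$-NE;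 in particular, if $(x,y)$ is a Nash equilibrium then so is $(x',y)$. -/

import Mathlib

open Classical in
/-- The actions available at `h` in a tree `nodes`. A node is the list of actions leading to it,
MOST RECENT ACTION FIRST, so that the child of `h` along the action `a` is `a :: h`, the root is
`[]`, and `h` is an ancestor of `h'` iff `h <:+ h'` (suffix). -/
noncomputable def legalActions {α : Type*} (nodes : Finset (List α)) (h : List α) : Finset α :=
  nodes.preimage (fun a => a :: h) (fun _ _ _ _ e => (List.cons.inj e).1)

inductive Player
  | plus
  | minus

/-- The raw data of a finite extensive-form game with explicit observations: a finite tree of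
nodes, utilities (to the player `plus`) at leaves, the player to move at internal nodes (`none`
is nature), the observation each player makes at each internal node, and nature's distribution at
her nodes. Values at irrelevant arguments (e.g. the utility of an internal node) are never used. -/
structure GameData (α Ω : Type*) where
  nodes : Finset (List α)
  root_mem : [] ∈ nodes
  parent_mem : ∀ {a : α} {h : List α}, a :: h ∈ nodes → h ∈ nodes
  utility : List α → ℝ
  turn : List α → Option Player
  obs : Player → List α → Ω
  natureProb : List α → α → ℝ

namespace GameData

variable {α Ω : Type*} (D : GameData α Ω)

/-- A leaf of the tree. -/
def IsTerminal (h : List α) : Prop := legalActions D.nodes h = ∅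

open Classical in
/-- What player `i` has seen and done on the way to `h`, before observing anything at `h` itself
(most recent entry first; `inl` is an observation, `inr` an action of player `i`). -/
noncomputable def past (i : Player) : List α → List (Ω ⊕ α)
  | [] => []
  | a :: h => (if D.turn h = some i then [Sum.inr a] else []) ++ Sum.inl (D.obs i h) :: past i h

open Classical in
/-- The observation sequence `s_i(h)` of player `i` at `h`, immediately after she makes her
observation at `h`; no observation is made at leaves. -/
noncomputable def seq (i : Player) (h : List α) : List (Ω ⊕ α) :=
  if D.IsTerminal h then D.past i h else Sum.inl (D.obs i h) :: D.past i h

end GameData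

/-- A finite two-player zero-sum extensive-form game with explicit observations. -/
structure Game (α Ω : Type*) extends GameData α Ω where
  nature_nonneg : ∀ h ∈ nodes, turn h = none → ∀ a ∈ legalActions nodes h, 0 ≤ natureProb h a
  nature_sum : ∀ h ∈ nodes, ¬ toGameData.IsTerminal h → turn h = none →
    ∑ a ∈ legalActions nodes h, natureProb h a = 1
  /-- An observation tells a player whether it is her turn. -/
  obs_turn : ∀ i, ∀ h ∈ nodes, ∀ h' ∈ nodes,
    ¬ toGameData.IsTerminal h → ¬ toGameData.IsTerminal h' →
    obs i h = obs i h' → (turn h = some i ↔ turn h' = some i)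
  /-- The same actions are available at indistinguishable nodes of the player to move. -/
  legal_eq : ∀ i, ∀ h ∈ nodes, ∀ h' ∈ nodes,
    ¬ toGameData.IsTerminal h → ¬ toGameData.IsTerminal h' →
    turn h = some i → turn h' = some i → h.length = h'.length →
    toGameData.seq i h = toGameData.seq i h' → legalActions nodes h = legalActions nodes h'

namespace Game

variable {α Ω : Type*} (G : Game α Ω)

abbrev Node : Type _ := {h : List α // h ∈ G.nodes}

open Classical in
noncomputable def terminals : Finset (List α) := G.nodes.filter (fun h => G.IsTerminal h)

open Classical in
/-- `p(h)`: the probability that nature plays all her actions on the path to `h`. -/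
noncomputable def natureReach : List α → ℝ
  | [] => 1
  | a :: h => (if G.turn h = none then G.natureProb h a else 1) * natureReach h

/-- A sequence-form mixed strategy of player `i`: `x s` is the probability that she plays all her
actions in the sequence `s`. (Coordinates at lists that are not sequences of the game are
irrelevant.) -/
structure Strategy (i : Player) where
  toFun : List (Ω ⊕ α) → ℝ
  nonneg : ∀ s, 0 ≤ toFun s
  root : toFun [] = 1
  observe : ∀ h ∈ G.nodes, toFun (G.seq i h) = toFun (G.past i h)
  act : ∀ h ∈ G.nodes, ¬ G.IsTerminal h → G.turn h = some i →
    ∑ a ∈ legalActions G.nodes h, toFun (Sum.inr a :: G.seq i h) = toFun (G.seq i h)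

variable {G}

/-- `x(h) = x(s_i(h))`. -/
noncomputable def Strategy.reach {i : Player} (x : G.Strategy i) (h : List α) : ℝ :=
  x.toFun (G.seq i h)

variable (G)

/-- The expected utility `u(x, y)` to the player `plus`. -/
noncomputable def payoff (x : G.Strategy .plus) (y : G.Strategy .minus) : ℝ :=
  ∑ z ∈ G.terminals, G.utility z * G.natureReach z * x.reach z * y.reach z

/-- The best-response value `u^*(x) = min_y u(x, y)`. -/
noncomputable def bestResponseValue (x : G.Strategy .plus) : ℝ :=
  ⨅ y : G.Strategy .minus, G.payoff x y

/-- Both players play `ε`-best responses in the profile `(x, y)`. -/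
def IsEpsNash (ε : ℝ) (x : G.Strategy .plus) (y : G.Strategy .minus) : Prop :=
  (∀ x' : G.Strategy .plus, G.payoff x' y - ε ≤ G.payoff x y) ∧
  (∀ y' : G.Strategy .minus, G.payoff x y ≤ G.payoff x y' + ε)

/-- `x` is an `ε`-NE strategy: its exploitability is at most `ε`, i.e. the value it guarantees is
within `ε` of the best value that any strategy of `plus` guarantees. -/
def IsEpsNEStrategy (ε : ℝ) (x : G.Strategy .plus) : Prop :=
  ∀ x' : G.Strategy .plus, G.bestResponseValue x' - ε ≤ G.bestResponseValue x

/-- Indistinguishability `h ∼_i h'`. -/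
def indist (i : Player) : Setoid G.Node where
  r h h' := h.1.length = h'.1.length ∧ G.seq i h.1 = G.seq i h'.1
  iseqv := ⟨fun _ => ⟨rfl, rfl⟩, fun e => ⟨e.1.symm, e.2.symm⟩,
    fun e f => ⟨e.1.trans f.1, e.2.trans f.2⟩⟩

/-- Infosets of player `i`: classes of nodes (whether or not `i` moves there). -/
abbrev Infoset (i : Player) : Type _ := Quotient (G.indist i)

/-- The infoset of player `i` containing `h`. -/
def infosetOf (i : Player) (h : G.Node) : G.Infoset i := Quotient.mk (G.indist i) h

noncomputable instance (i : Player) : Fintype (G.Infoset i) :=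
  @Fintype.ofFinite _ (Quotient.finite _)

variable {G}

/-- `h ⪰ I`: the node `h` has an ancestor (possibly itself) in `I`. -/
def IsBelow {i : Player} (I : G.Infoset i) (h : List α) : Prop :=
  ∃ k : G.Node, G.infosetOf i k = I ∧ k.1 <:+ h

/-- `I' ⪯ I`: the infoset `I'` is an ancestor of (or equal to) `I`. -/
def IsAncestor {i : Player} (I' I : G.Infoset i) : Prop :=
  ∃ h : G.Node, G.infosetOf i h = I ∧ IsBelow I' h.1

variable (G)

/-- The graph on the infosets of `plus` in which two distinct infosets are adjacent when they
contain nodes that lie in the same infoset of `minus`. -/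
def infosetGraph : SimpleGraph (G.Infoset .plus) where
  Adj I I' := I ≠ I' ∧ ∃ h h' : G.Node, G.infosetOf .plus h = I ∧ G.infosetOf .plus h' = I' ∧
    G.infosetOf .minus h = G.infosetOf .minus h'
  symm := ⟨fun _ _ ⟨hne, h, h', e, e', e''⟩ => ⟨hne.symm, h', h, e', e, e''.symm⟩⟩
  loopless := ⟨fun _ h => h.1 rfl⟩

/-! ### Knowledge-limited subgame solving of order one -/

/-- `y(K) = 1`. -/
def Reaches (y : G.Strategy .minus) (K : G.Infoset .minus) : Prop :=
  ∀ h : G.Node, G.infosetOf .minus h = K → y.reach h.1 = 1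

open Classical in
/-- The contribution to `u(x, y)` of the leaves below the `minus`-infoset `K`. -/
noncomputable def valueBelow (x : G.Strategy .plus) (y : G.Strategy .minus)
    (K : G.Infoset .minus) : ℝ :=
  ∑ z ∈ G.terminals.filter (fun z => IsBelow K z),
    G.utility z * G.natureReach z * x.reach z * y.reach z

/-- Which gadget game is solved. -/
inductive Gadget
  | maxmargin
  | resolving

/-- How values at a `minus`-infoset `K` are normalized when solving at a `plus`-infoset `I`: by
the probability mass of all of `K`, or by that of `K ∩ I`. -/
inductive Normalization
  | whole
  | inside

open Classical in
/-- The normalization constant: `∑ p(h) x(h)` over `h ∈ K`, respectively `h ∈ K ∩ I`. -/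
noncomputable def mass (n : Normalization) (x : G.Strategy .plus) (I : G.Infoset .plus)
    (K : G.Infoset .minus) : ℝ :=
  match n with
  | .whole => ∑ h : G.Node with G.infosetOf .minus h = K, G.natureReach h.1 * x.reach h.1
  | .inside => ∑ h : G.Node with G.infosetOf .minus h = K ∧ G.infosetOf .plus h = I,
      G.natureReach h.1 * x.reach h.1

/-- The counterfactual best-response value `u^*(x|K)` of `minus` at her infoset `K`. -/
noncomputable def cfValue (n : Normalization) (x : G.Strategy .plus) (I : G.Infoset .plus)
    (K : G.Infoset .minus) : ℝ :=
  (⨅ y : {y : G.Strategy .minus // G.Reaches y K}, G.valueBelow x y.1 K) / G.mass n x I K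

open Classical in
/-- The infosets of `minus` at which the gadget game for `I` starts: those that meet `I` in a node
of positive probability under nature and the blueprint `x`. -/
noncomputable def gadgetRoots (x : G.Strategy .plus) (I : G.Infoset .plus) :
    Finset (G.Infoset .minus) :=
  Finset.univ.filter (fun K => 0 < G.mass .inside x I K)

/-- A mixed strategy of `minus` in the gadget game for `I`. In the maxmargin gadget, `weight` is
the distribution with which she picks the starting infoset; in the resolving gadget, in which
nature picks it uniformly, `weight K` is the probability with which she plays on (rather than
exits) at `K`. After that she continues from `K` according to `cont K`. -/
structure GadgetReply (g : Gadget) (x : G.Strategy .plus) (I : G.Infoset .plus) where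
  weight : G.Infoset .minus → ℝ
  weight_nonneg : ∀ K, 0 ≤ weight K
  weight_maxmargin : g = .maxmargin → ∑ K ∈ G.gadgetRoots x I, weight K = 1
  weight_resolving : g = .resolving → ∀ K, weight K ≤ 1
  cont : G.Infoset .minus → G.Strategy .minus
  cont_reaches : ∀ K, G.Reaches (cont K) K

variable {G}

/-- The probability with which nature selects a root in the resolving gadget; in the maxmargin
gadget the choice is made by `minus`, and there is no such factor. -/
noncomputable def rootChance (g : Gadget) (x : G.Strategy .plus) (I : G.Infoset .plus) : ℝ :=
  match g with
  | .maxmargin => 1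
  | .resolving => 1 / ((G.gadgetRoots x I).card : ℝ)

/-- The payoff to `plus` in the gadget game for `I` with blueprint `x`, when `plus` plays `x'`:
starting at `K`, she is paid the normalized value of the play below `K` minus the alternate
payoff `u^*(x|K)`; exiting is worth `0`. -/
noncomputable def gadgetPayoff (g : Gadget) (n : Normalization) (x : G.Strategy .plus)
    (I : G.Infoset .plus) (x' : G.Strategy .plus) (r : G.GadgetReply g x I) : ℝ :=
  ∑ K ∈ G.gadgetRoots x I, rootChance g x I * (r.weight K *
    (G.valueBelow x' (r.cont K) K / G.mass n x I K - G.cfValue n x I K))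

/-- `x'` agrees with `x` at all nodes outside `{h : h ⪰ I}`. -/
def AgreesOutside (I : G.Infoset .plus) (x x' : G.Strategy .plus) : Prop :=
  ∀ h ∈ G.nodes, ¬ IsBelow I h → x'.reach h = x.reach h

/-- `x'` is a possible result of `1`-KLSS at `I` with blueprint `x`: the strategy of `plus` is
fixed to `x` outside `{h : h ⪰ I}`, and `(x', r)` is a Nash equilibrium of the gadget game for
some `r`. If `I` has probability zero under nature and `x`, there is no gadget game, and only the
first condition remains. -/
def IsOneKLSS (g : Gadget) (n : Normalization) (x : G.Strategy .plus) (I : G.Infoset .plus)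
    (x' : G.Strategy .plus) : Prop :=
  AgreesOutside I x x' ∧
  ((G.gadgetRoots x I).Nonempty → ∃ r : G.GadgetReply g x I,
    (∀ x'' : G.Strategy .plus, AgreesOutside I x x'' →
      gadgetPayoff g n x I x'' r ≤ gadgetPayoff g n x I x' r) ∧
    (∀ r' : G.GadgetReply g x I, gadgetPayoff g n x I x' r ≤ gadgetPayoff g n x I x' r'))

open Classical in
/-- The strategy that `plus` is following when she arrives at `h`, before any solve at `h`: the
result `sol J` of the solve at the last infoset `J ∈ S` that she passed strictly before `h`, and
the blueprint `x` if there is none. -/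
noncomputable def strategyBefore (x : G.Strategy .plus) (S : Set (G.Infoset .plus))
    (sol : G.Infoset .plus → G.Strategy .plus) : (h : List α) → h ∈ G.nodes → G.Strategy .plus
  | [], _ => x
  | _ :: h, hm =>
      if G.infosetOf .plus ⟨h, G.parent_mem hm⟩ ∈ S
      then sol (G.infosetOf .plus ⟨h, G.parent_mem hm⟩)
      else strategyBefore x S sol h (G.parent_mem hm)

open Classical in
/-- The strategy that `plus` is following at `h`, after the solve (if any) at `h`. -/
noncomputable def strategyAt (x : G.Strategy .plus) (S : Set (G.Infoset .plus))
    (sol : G.Infoset .plus → G.Strategy .plus) (h : G.Node) : G.Strategy .plus :=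
  if G.infosetOf .plus h ∈ S then sol (G.infosetOf .plus h)
  else strategyBefore x S sol h.1 h.2

/-- `x'` results from the blueprint `x` by performing `1`-KLSS, nested along the play, at every
infoset in `S`. The solve at `I ∈ S` yields `sol I`; its blueprint is the strategy currently
followed, and its variant is `g I`, `n I`. The strategy `x'` plays at each node according to the
most recent solve. -/
structure IsNestedOneKLSS (g : G.Infoset .plus → Gadget) (n : G.Infoset .plus → Normalization)
    (x : G.Strategy .plus) (S : Set (G.Infoset .plus))
    (sol : G.Infoset .plus → G.Strategy .plus) (x' : G.Strategy .plus) : Prop where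
  solve : ∀ h : G.Node, G.infosetOf .plus h ∈ S →
    IsOneKLSS (g (G.infosetOf .plus h)) (n (G.infosetOf .plus h))
      (strategyBefore x S sol h.1 h.2) (G.infosetOf .plus h) (sol (G.infosetOf .plus h))
  play : ∀ h : G.Node, x'.reach h.1 = (strategyAt x S sol h).reach h.1

end Game

/-! The heart is `IsNestedOneKLSS.dominates`: for every reply to `x'` and every `η > 0` there is a
reply to `x` that costs `plus` at most `η` more. Hence solving does not lower the best-response
value, which gives both claims. The slack `η` spares showing that the infima are attained. One solve
is safe at each root `K` of its gadget game: keeping the blueprint guarantees `plus` at least 0, so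
in equilibrium no continuation of `minus` from `K` beats the alternate payoff
(`IsOneKLSS.iInf_le_valueBelow`). Rescaling by `y(K)` and splicing strategies at `K` turns this into
a statement about arbitrary replies (`IsOneKLSS.exists_reply`). A solve at `I` certifies `K` only
with the rest of `K` held at the blueprint, so two solves meeting the same `K` could spoil each
other. Independence excludes this. Together with ancestor-closure it also makes the strategies on
arrival at the nodes of `K` agree below `K` (`IsNestedOneKLSS.reach_strategyBefore_eq`), so there
the nested procedure looks like a single solve. The solves are then switched on depth by depth and,
within one depth, one `minus`-infoset at a time. -/

/-! ### Sequences and perfect recall. -/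

namespace GameData

variable {α Ω : Type*} {D : GameData α Ω} {i : Player} {h h' z : List α} {a a' : α}

theorem mem_of_suffix (hs : h <:+ z) (hz : z ∈ D.nodes) : h ∈ D.nodes := by
  induction z with
  | nil => rwa [List.suffix_nil.1 hs]
  | cons b z ih =>
    rcases List.suffix_cons_iff.1 hs with rfl | hs
    · exact hz
    · exact ih hs (D.parent_mem hz)

theorem mem_legalActions {nodes : Finset (List α)} :
    a ∈ legalActions nodes h ↔ a :: h ∈ nodes := by
  unfold legalActions
  exact Finset.mem_preimage

theorem not_isTerminal_of_cons_mem (hm : a :: h ∈ D.nodes) : ¬ D.IsTerminal h := fun ht => by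
  have := mem_legalActions.2 hm
  rw [show legalActions D.nodes h = ∅ from ht] at this
  simp at this

theorem seq_of_not_isTerminal (hn : ¬ D.IsTerminal h) :
    D.seq i h = Sum.inl (D.obs i h) :: D.past i h := if_neg hn

theorem seq_of_isTerminal (ht : D.IsTerminal h) : D.seq i h = D.past i h := if_pos ht

theorem past_cons_of_turn (hn : ¬ D.IsTerminal h) (ht : D.turn h = some i) :
    D.past i (a :: h) = Sum.inr a :: D.seq i h := by
  simp [past, ht, seq_of_not_isTerminal hn]

theorem past_cons_of_not_turn (hn : ¬ D.IsTerminal h) (ht : D.turn h ≠ some i) :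
    D.past i (a :: h) = D.seq i h := by
  simp [past, ht, seq_of_not_isTerminal hn]

/-- Sequences thus encode depth: every internal node on the way contributes exactly one observation.
-/
theorem countP_isLeft_past : ∀ h : List α, (D.past i h).countP Sum.isLeft = h.length
  | [] => rfl
  | a :: h => by
    have := countP_isLeft_past h
    by_cases ht : D.turn h = some i <;> simp [past, ht, List.countP_cons, this]

/-- Indistinguishable nodes are both internal or both leaves, and have the same past. -/
theorem past_eq_of_seq_eq (hl : h.length = h'.length) (hs : D.seq i h = D.seq i h') :
    D.past i h = D.past i h' := by
  -- At depth `d` the sequence of a leaf holds `d` observations and that of an internal node `d +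
  -- 1`, so the mixed cases are impossible.
  have hc := congrArg (List.countP Sum.isLeft) hs
  unfold seq at hs hc
  split_ifs at hs hc
  · exact hs
  · simp [List.countP_cons, countP_isLeft_past, hl] at hc
  · simp [List.countP_cons, countP_isLeft_past, hl] at hc
  · exact (List.cons.inj hs).2

/-- Perfect recall, one step back. If the player moved at only one of the parents, one past would
start with an action and the other with an observation. -/
theorem seq_eq_of_cons (hm : a :: h ∈ D.nodes) (hm' : a' :: h' ∈ D.nodes)
    (hp : D.past i (a :: h) = D.past i (a' :: h')) : D.seq i h = D.seq i h' := by
  have hn := not_isTerminal_of_cons_mem hm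
  have hn' := not_isTerminal_of_cons_mem hm'
  by_cases ht : D.turn h = some i <;> by_cases ht' : D.turn h' = some i
  · rw [past_cons_of_turn hn ht, past_cons_of_turn hn' ht'] at hp
    exact (List.cons.inj hp).2
  · rw [past_cons_of_turn hn ht, past_cons_of_not_turn hn' ht', seq_of_not_isTerminal hn'] at hp
    simp at hp
  · rw [past_cons_of_not_turn hn ht, past_cons_of_turn hn' ht', seq_of_not_isTerminal hn] at hp
    simp at hp
  · rwa [past_cons_of_not_turn hn ht, past_cons_of_not_turn hn' ht'] at hp

theorem past_suffix_seq : D.past i h <:+ D.seq i h := by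
  unfold seq
  split_ifs
  · exact List.suffix_rfl
  · exact List.suffix_cons _ _

theorem seq_suffix_past_cons (hn : ¬ D.IsTerminal h) : D.seq i h <:+ D.past i (a :: h) := by
  rw [seq_of_not_isTerminal hn]
  exact List.suffix_append _ _

theorem seq_suffix_seq (hs : h <:+ z) (hz : z ∈ D.nodes) : D.seq i h <:+ D.seq i z := by
  induction z with
  | nil => rw [List.suffix_nil.1 hs]
  | cons b z ih =>
    rcases List.suffix_cons_iff.1 hs with rfl | hs
    · exact List.suffix_rfl
    · exact ((ih hs (D.parent_mem hz)).trans
        (seq_suffix_past_cons (not_isTerminal_of_cons_mem hz))).trans past_suffix_seq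

theorem not_isTerminal_of_suffix (hs : h <:+ z) (hz : z ∈ D.nodes) (hl : h.length < z.length) :
    ¬ D.IsTerminal h := by
  induction z with
  | nil => simp at hl
  | cons b z ih =>
    rcases List.suffix_cons_iff.1 hs with rfl | hs
    · simp at hl
    · rcases hs.length_le.eq_or_lt with he | hlt
      · rw [hs.eq_of_length he]
        exact not_isTerminal_of_cons_mem hz
      · exact ih hs (D.parent_mem hz) hlt

end GameData

theorem List.IsSuffix.eq_of_isSuffix_of_length_eq {β : Type*} {l₁ l₂ l : List β}
    (h₁ : l₁ <:+ l) (h₂ : l₂ <:+ l) (hl : l₁.length = l₂.length) : l₁ = l₂ :=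
  (List.suffix_of_suffix_length_le h₁ h₂ hl.le).eq_of_length hl

/-- Two suffixes of a list that start with an `inl` and contain equally many are equal. -/
theorem List.suffix_eq_of_countP_isLeft {β γ : Type*} {b b' : β} {l l' s : List (β ⊕ γ)}
    (h : Sum.inl b :: l <:+ s) (h' : Sum.inl b' :: l' <:+ s)
    (hc : l.countP Sum.isLeft = l'.countP Sum.isLeft) :
    (Sum.inl b :: l : List (β ⊕ γ)) = Sum.inl b' :: l' := by
  wlog hle : l.length ≤ l'.length generalizing b b' l l'
  · exact (this h' h hc.symm (le_of_not_ge hle)).symm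
  rcases List.suffix_cons_iff.1
    (List.suffix_of_suffix_length_le h h' (by simpa using hle)) with he | hs
  · exact he
  · have := hs.sublist.countP_le (p := Sum.isLeft)
    simp [List.countP_cons, hc] at this

/-! ### Infosets and reach probabilities. -/

namespace Game

variable {α Ω : Type*} {G : Game α Ω} {i : Player} {h h' z : List α} {a : α}

open GameData

theorem infosetOf_eq_iff {h h' : G.Node} : G.infosetOf i h = G.infosetOf i h' ↔
    h.1.length = h'.1.length ∧ G.seq i h.1 = G.seq i h'.1 := Quotient.eq

theorem infosetOf_parent_eq {a a' : α} {h h' : List α} (hm : a :: h ∈ G.nodes)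
    (hm' : a' :: h' ∈ G.nodes)
    (he : G.infosetOf i ⟨a :: h, hm⟩ = G.infosetOf i ⟨a' :: h', hm'⟩) :
    G.infosetOf i ⟨h, G.parent_mem hm⟩ = G.infosetOf i ⟨h', G.parent_mem hm'⟩ := by
  obtain ⟨hl, hs⟩ := infosetOf_eq_iff.1 he
  exact infosetOf_eq_iff.2
    ⟨by simpa using hl, seq_eq_of_cons hm hm' (past_eq_of_seq_eq hl hs)⟩

theorem isBelow_infosetOf_iff {k : G.Node} : IsBelow (G.infosetOf i k) z ↔
    ∃ h : G.Node, h.1 <:+ z ∧ h.1.length = k.1.length ∧ G.seq i h.1 = G.seq i k.1 := by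
  simp only [IsBelow, infosetOf_eq_iff]
  exact ⟨fun ⟨h, e, s⟩ => ⟨h, s, e⟩, fun ⟨h, s, e⟩ => ⟨h, e, s⟩⟩

/-- A node lies below the infosets of its ancestors, and below no other infosets of their depth. -/
theorem isBelow_infosetOf_iff_of_suffix {h k : G.Node} (hs : h.1 <:+ z)
    (hl : h.1.length = k.1.length) :
    IsBelow (G.infosetOf i k) z ↔ G.infosetOf i h = G.infosetOf i k := by
  refine ⟨fun ⟨k', e, s⟩ => ?_, fun e => ⟨h, e, hs⟩⟩
  rwa [show h = k' from Subtype.ext (hs.eq_of_isSuffix_of_length_eq s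
    (hl.trans (infosetOf_eq_iff.1 e).1.symm))]

namespace Strategy

variable (x : G.Strategy i)

theorem reach_nonneg (h : List α) : 0 ≤ x.reach h := x.nonneg _

theorem reach_nil : x.reach [] = 1 := (x.observe _ G.root_mem).trans x.root

theorem reach_eq (hm : h ∈ G.nodes) : x.reach h = x.toFun (G.past i h) := x.observe h hm

theorem reach_cons_of_turn (hm : a :: h ∈ G.nodes) (ht : G.turn h = some i) :
    x.reach (a :: h) = x.toFun (Sum.inr a :: G.seq i h) := by
  rw [reach_eq x hm, past_cons_of_turn (not_isTerminal_of_cons_mem hm) ht]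

theorem reach_cons_of_not_turn (hm : a :: h ∈ G.nodes) (ht : G.turn h ≠ some i) :
    x.reach (a :: h) = x.reach h := by
  rw [reach_eq x hm, past_cons_of_not_turn (not_isTerminal_of_cons_mem hm) ht, reach]

theorem sum_reach_cons (hm : h ∈ G.nodes) (hn : ¬ G.IsTerminal h) (ht : G.turn h = some i) :
    ∑ a ∈ legalActions G.nodes h, x.reach (a :: h) = x.reach h := by
  rw [reach, ← x.act h hm hn ht]
  exact Finset.sum_congr rfl fun a ha => x.reach_cons_of_turn (mem_legalActions.1 ha) ht

theorem reach_cons_le (hm : a :: h ∈ G.nodes) : x.reach (a :: h) ≤ x.reach h := by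
  by_cases ht : G.turn h = some i
  · rw [← x.sum_reach_cons (G.parent_mem hm) (not_isTerminal_of_cons_mem hm) ht]
    exact Finset.single_le_sum (f := fun b => x.reach (b :: h)) (fun b _ => x.reach_nonneg _)
      (mem_legalActions.2 hm)
  · exact (x.reach_cons_of_not_turn hm ht).le

theorem reach_le_of_suffix (hs : h <:+ z) (hz : z ∈ G.nodes) : x.reach z ≤ x.reach h := by
  induction z with
  | nil => rw [List.suffix_nil.1 hs]
  | cons b z ih =>
    rcases List.suffix_cons_iff.1 hs with rfl | hs
    · exact le_rfl
    · exact (x.reach_cons_le hz).trans (ih hs (G.parent_mem hz))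

theorem reach_le_one (hz : z ∈ G.nodes) : x.reach z ≤ 1 :=
  (x.reach_le_of_suffix (List.nil_suffix) hz).trans x.reach_nil.le

theorem reach_eq_zero_of_suffix (hs : h <:+ z) (hz : z ∈ G.nodes) (h0 : x.reach h = 0) :
    x.reach z = 0 :=
  le_antisymm (h0 ▸ x.reach_le_of_suffix hs hz) (x.reach_nonneg _)

end Strategy

theorem natureReach_nonneg (hm : h ∈ G.nodes) : 0 ≤ G.natureReach h := by
  induction h with
  | nil => simp [natureReach]
  | cons a h ih =>
    rw [natureReach]
    refine mul_nonneg ?_ (ih (G.parent_mem hm))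
    split_ifs with ht
    · exact G.nature_nonneg h (G.parent_mem hm) ht a (mem_legalActions.2 hm)
    · exact zero_le_one

theorem natureReach_eq_zero_of_suffix (hs : h <:+ z) (h0 : G.natureReach h = 0) :
    G.natureReach z = 0 := by
  induction z with
  | nil => rwa [← List.suffix_nil.1 hs]
  | cons b z ih =>
    rcases List.suffix_cons_iff.1 hs with rfl | hs
    · exact h0
    · rw [natureReach, ih hs, mul_zero]

theorem mem_terminals : z ∈ G.terminals ↔ z ∈ G.nodes ∧ G.IsTerminal z := by
  simp [terminals]

open Classical in
/-- Strategies that agree outside `{h : h ⪰ I}` agree also at `I` itself. -/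
theorem AgreesOutside.reach_eq {x x' : G.Strategy .plus} {k : G.Node}
    (H : AgreesOutside (G.infosetOf .plus k) x x') : x'.reach k.1 = x.reach k.1 := by
  obtain ⟨k, hk⟩ := k
  cases k with
  | nil => rw [Strategy.reach_nil, Strategy.reach_nil]
  | cons a h =>
    have hm := G.parent_mem hk
    have hn := not_isTerminal_of_cons_mem hk
    have hpar : x'.reach h = x.reach h := by
      refine H h hm fun ⟨k', e, s⟩ => ?_
      have := (infosetOf_eq_iff.1 e).1
      have := s.length_le
      simp_all
    by_cases ht : G.turn h = some .plus
    · have h1 := x.sum_reach_cons hm hn ht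
      have h2 := x'.sum_reach_cons hm hn ht
      -- The siblings of `a :: h` lie outside `I`, because the past records the action played. Both
      -- strategies agree there and at `h`, so conservation of probability at `h` forces agreement
      -- at `a :: h`.
      rw [← Finset.add_sum_erase _ _ (mem_legalActions.2 hk)] at h1 h2
      have h3 : ∑ c ∈ (legalActions G.nodes h).erase a, x'.reach (c :: h) =
          ∑ c ∈ (legalActions G.nodes h).erase a, x.reach (c :: h) := by
        refine Finset.sum_congr rfl fun c hc => ?_
        obtain ⟨hca, hc⟩ := Finset.mem_erase.1 hc
        have hcm := mem_legalActions.1 hc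
        refine H _ hcm fun hb => hca ?_
        have e := infosetOf_eq_iff.1
          ((isBelow_infosetOf_iff_of_suffix (h := ⟨c :: h, hcm⟩) List.suffix_rfl
            (by simp)).1 hb)
        have := past_eq_of_seq_eq e.1 e.2
        rw [past_cons_of_turn hn ht, past_cons_of_turn hn ht] at this
        exact Sum.inr.inj (List.cons.inj this).1
      dsimp only at *
      linarith
    · dsimp only
      rw [Strategy.reach_cons_of_not_turn _ hk ht, Strategy.reach_cons_of_not_turn _ hk ht, hpar]

/-! ### Splicing two strategies at an infoset. -/

open Classical in
/-- Replace `y` by `c • w` at and below the infoset of `k`. -/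
noncomputable def Strategy.glue {i : Player} (k : G.Node) (hk : ¬ G.IsTerminal k.1)
    (y w : G.Strategy i) (c : ℝ) (hc : 0 ≤ c) (hw : c * w.reach k.1 = y.reach k.1) :
    G.Strategy i where
  -- Since `k` is internal, its sequence starts with an observation. The switch from `y` to `c • w`
  -- can then occur only in the `observe` constraint, where `hw` makes the two sides match, and
  -- never in `root` or across an action.
  toFun s := if G.seq i k.1 <:+ s then c * w.toFun s else y.toFun s
  nonneg s := by
    split_ifs
    · exact mul_nonneg hc (w.nonneg _)
    · exact y.nonneg _
  root := by
    rw [if_neg, y.root]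
    rw [seq_of_not_isTerminal hk]
    simp
  observe h hm := by
    by_cases hp : G.seq i k.1 <:+ G.past i h
    · rw [if_pos hp, if_pos (hp.trans past_suffix_seq), w.observe h hm]
    · rw [if_neg hp]
      split_ifs with hs
      · have he : G.seq i k.1 = G.seq i h := by
          by_cases ht : G.IsTerminal h
          · rw [seq_of_isTerminal ht] at hs
            exact absurd hs hp
          · rw [seq_of_not_isTerminal ht] at hs ⊢
            exact (List.suffix_cons_iff.1 hs).resolve_right hp
        rw [← y.observe h hm, ← he]
        exact hw
      · exact y.observe h hm
  act h hm hn ht := by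
    have key : ∀ a : α, G.seq i k.1 <:+ Sum.inr a :: G.seq i h ↔ G.seq i k.1 <:+ G.seq i h := by
      intro a
      rw [List.suffix_cons_iff, or_iff_right]
      rw [seq_of_not_isTerminal hk]
      simp
    simp only [key]
    split_ifs
    · rw [← Finset.mul_sum, w.act h hm hn ht]
    · exact y.act h hm hn ht

section Glue

variable {k : G.Node} {hk : ¬ G.IsTerminal k.1} {y w : G.Strategy i} {c : ℝ} {hc : 0 ≤ c}
  {hw : c * w.reach k.1 = y.reach k.1}

theorem Strategy.reach_glue_of_isBelow (hz : z ∈ G.nodes) (hb : IsBelow (G.infosetOf i k) z) :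
    (y.glue k hk w c hc hw).reach z = c * w.reach z := by
  obtain ⟨h, hs, -, he⟩ := isBelow_infosetOf_iff.1 hb
  exact if_pos (he ▸ seq_suffix_seq hs hz)

theorem Strategy.reach_glue_of_not_isBelow (hz : z ∈ G.terminals)
    (hb : ¬ IsBelow (G.infosetOf i k) z) :
    (y.glue k hk w c hc hw).reach z = y.reach z := by
  obtain ⟨hzm, hzt⟩ := mem_terminals.1 hz
  refine if_neg fun hs => hb (isBelow_infosetOf_iff.2 ?_)
  -- Counting observations shows that `z` is deeper than `k`; its ancestor at the depth of `k` is
  -- then the candidate for a node of the infoset of `k`.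
  have hlen : k.1.length < z.length := by
    have := hs.sublist.countP_le (p := Sum.isLeft)
    rw [seq_of_isTerminal hzt, seq_of_not_isTerminal hk] at this
    simpa [List.countP_cons, countP_isLeft_past, Nat.succ_le_iff] using this
  have hsuf : z.drop (z.length - k.1.length) <:+ z := List.drop_suffix _ _
  have hl : (z.drop (z.length - k.1.length)).length = k.1.length := by
    rw [List.length_drop]; omega
  refine ⟨⟨_, mem_of_suffix hsuf hzm⟩, hsuf, hl, ?_⟩
  have hn := not_isTerminal_of_suffix hsuf hzm (hl.trans_lt hlen)
  have h1 := seq_suffix_seq (i := i) hsuf hzm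
  dsimp only
  rw [seq_of_not_isTerminal hn] at h1 ⊢
  rw [seq_of_not_isTerminal hk] at hs ⊢
  exact List.suffix_eq_of_countP_isLeft h1 hs (by rw [countP_isLeft_past, countP_isLeft_past, hl])

end Glue

end Game


namespace Game

variable {α Ω : Type*} {G : Game α Ω}

open GameData

/-! ### Partial payoffs -/

variable (G) in
/-- The payoff of `y` when the leaf `z` is reached by `plus` with weight `X z`. -/
noncomputable def weightedPayoff (X : List α → ℝ) (y : G.Strategy .minus) : ℝ :=
  ∑ z ∈ G.terminals, G.utility z * G.natureReach z * X z * y.reach z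

open Classical in
variable (G) in
/-- The part of `weightedPayoff` that comes from the leaves below `K`. -/
noncomputable def weightedPayoffBelow (X : List α → ℝ) (y : G.Strategy .minus)
    (K : G.Infoset .minus) : ℝ :=
  ∑ z ∈ G.terminals.filter (fun z => IsBelow K z),
    G.utility z * G.natureReach z * X z * y.reach z

variable (G) in
/-- Against `X'`, the player `minus` can do no better than against `X`. -/
def Dominates (X' X : List α → ℝ) : Prop :=
  ∀ (y : G.Strategy .minus), ∀ η > 0, ∃ y' : G.Strategy .minus,
    G.weightedPayoff X y' ≤ G.weightedPayoff X' y + η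

theorem Dominates.trans {X₁ X₂ X₃ : List α → ℝ} (h₁ : G.Dominates X₁ X₂)
    (h₂ : G.Dominates X₂ X₃) : G.Dominates X₁ X₃ := fun y η hη => by
  obtain ⟨y₁, hy₁⟩ := h₁ y (η / 2) (half_pos hη)
  obtain ⟨y₂, hy₂⟩ := h₂ y₁ (η / 2) (half_pos hη)
  exact ⟨y₂, by linarith⟩

theorem Dominates.of_eqOn {X X' : List α → ℝ} (h : ∀ z ∈ G.terminals, X' z = X z) :
    G.Dominates X' X := fun y _ hη => ⟨y, by
  have : G.weightedPayoff X y = G.weightedPayoff X' y :=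
    Finset.sum_congr rfl fun z hz => by rw [h z hz]
  exact this ▸ le_add_of_nonneg_right hη.le⟩

open Classical in
/-- It is enough to improve the reply below an infoset outside which the weights agree. -/
theorem Dominates.of_below {X X' : List α → ℝ} {K : G.Infoset .minus}
    (hX : ∀ z ∈ G.terminals, ¬ IsBelow K z → X' z = X z)
    (H : ∀ (y : G.Strategy .minus), ∀ η > 0, ∃ y' : G.Strategy .minus,
      (∀ z ∈ G.terminals, ¬ IsBelow K z → y'.reach z = y.reach z) ∧
      G.weightedPayoffBelow X y' K ≤ G.weightedPayoffBelow X' y K + η) :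
    G.Dominates X' X := fun y η hη => by
  obtain ⟨y', hy, hle⟩ := H y η hη
  refine ⟨y', ?_⟩
  rw [weightedPayoff, weightedPayoff,
    ← Finset.sum_filter_add_sum_filter_not G.terminals (fun z => IsBelow K z),
    ← Finset.sum_filter_add_sum_filter_not (s := G.terminals) (p := fun z => IsBelow K z)
      (f := fun z => G.utility z * G.natureReach z * X' z * y.reach z)]
  have : ∑ z ∈ G.terminals with ¬ IsBelow K z,
        G.utility z * G.natureReach z * X z * y'.reach z =
      ∑ z ∈ G.terminals with ¬ IsBelow K z,
        G.utility z * G.natureReach z * X' z * y.reach z :=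
    Finset.sum_congr rfl fun z hz => by
      obtain ⟨hz, hb⟩ := Finset.mem_filter.1 hz
      rw [hX z hz hb, hy z hz hb]
  rw [this]
  unfold weightedPayoffBelow at hle
  linarith

theorem payoff_bddBelow (x : G.Strategy .plus) :
    BddBelow (Set.range fun y : G.Strategy .minus => G.payoff x y) := by
  refine ⟨-∑ z ∈ G.terminals, |G.utility z * G.natureReach z * x.reach z|, ?_⟩
  rintro _ ⟨y, rfl⟩
  rw [← Finset.sum_neg_distrib]
  refine Finset.sum_le_sum fun z hz => neg_le_of_abs_le ?_
  rw [abs_mul, abs_of_nonneg (y.reach_nonneg z)]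
  exact mul_le_of_le_one_right (abs_nonneg _) (y.reach_le_one (mem_terminals.1 hz).1)

open Classical in
theorem valueBelow_bddBelow (x : G.Strategy .plus) (K : G.Infoset .minus) :
    BddBelow (Set.range fun y : {y : G.Strategy .minus // G.Reaches y K} =>
      G.valueBelow x y.1 K) := by
  refine ⟨-∑ z ∈ G.terminals with IsBelow K z, |G.utility z * G.natureReach z * x.reach z|, ?_⟩
  rintro _ ⟨y, rfl⟩
  rw [← Finset.sum_neg_distrib]
  refine Finset.sum_le_sum fun z hz => neg_le_of_abs_le ?_
  rw [abs_mul, abs_of_nonneg (y.1.reach_nonneg z)]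
  exact mul_le_of_le_one_right (abs_nonneg _)
    (y.1.reach_le_one (mem_terminals.1 (Finset.mem_filter.1 hz).1).1)

/-! ### One solve -/

section Margin

variable {g : Gadget} {n : Normalization} {b s : G.Strategy .plus} {I : G.Infoset .plus}
  {K : G.Infoset .minus}

open Classical in
theorem mem_gadgetRoots : K ∈ G.gadgetRoots b I ↔ 0 < G.mass .inside b I K := by
  simp [gadgetRoots]

open Classical in
theorem mass_pos_of_mem_gadgetRoots (hK : K ∈ G.gadgetRoots b I) : 0 < G.mass n b I K := by
  have h := mem_gadgetRoots.1 hK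
  cases n with
  | inside => exact h
  | whole =>
    refine h.trans_le (Finset.sum_le_sum_of_subset_of_nonneg ?_ fun h _ _ =>
      mul_nonneg (natureReach_nonneg h.2) (b.reach_nonneg _))
    exact fun h hh => by simp_all

theorem rootChance_pos (hK : K ∈ G.gadgetRoots b I) : 0 < rootChance g b I := by
  cases g with
  | maxmargin => exact zero_lt_one
  | resolving => exact one_div_pos.2 (Nat.cast_pos.2 (Finset.card_pos.2 ⟨K, hK⟩))

/-- The blueprint itself guarantees a nonnegative payoff in the gadget game. -/
theorem gadgetPayoff_self_nonneg (r : G.GadgetReply g b I) : 0 ≤ gadgetPayoff g n b I b r := by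
  refine Finset.sum_nonneg fun K hK => mul_nonneg (rootChance_pos hK).le
    (mul_nonneg (r.weight_nonneg K) (sub_nonneg.2 ?_))
  exact div_le_div_of_nonneg_right
    (ciInf_le (valueBelow_bddBelow b K) ⟨r.cont K, r.cont_reaches K⟩)
    (mass_pos_of_mem_gadgetRoots hK).le

open Classical in
/-- A solve does not decrease the best-response values at the roots of the gadget game. -/
theorem IsOneKLSS.iInf_le_valueBelow (H : IsOneKLSS g n b I s) (hK : K ∈ G.gadgetRoots b I)
    (y : G.Strategy .minus) (hy : G.Reaches y K) :
    ⨅ w : {w : G.Strategy .minus // G.Reaches w K}, G.valueBelow b w.1 K ≤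
      G.valueBelow s y K := by
  obtain ⟨r, h₁, h₂⟩ := H.2 ⟨K, hK⟩
  -- The deviation that tests only `K`: choose it with certainty in the maxmargin gadget, exit
  -- everywhere else in the resolving one.
  let r' : G.GadgetReply g b I :=
    { weight := fun K' => if K' = K then 1 else 0
      weight_nonneg := fun K' => by positivity
      weight_maxmargin := fun _ => by simp [hK]
      weight_resolving := fun _ K' => by split_ifs <;> simp
      cont := fun K' => if K' = K then y else r.cont K'
      cont_reaches := fun K' => by
        split_ifs with h
        · rwa [h]
        · exact r.cont_reaches K' }
  -- Against the equilibrium reply, `s` does at least as well as the blueprint, hence at least 0;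
  -- and `minus` does not gain by moving to `r'`.
  have h0 : 0 ≤ gadgetPayoff g n b I s r' :=
    ((gadgetPayoff_self_nonneg r).trans (h₁ b fun _ _ _ => rfl)).trans (h₂ r')
  rw [gadgetPayoff, Finset.sum_eq_single K (fun K' _ h => by simp [r', h])
    (fun h => absurd hK h)] at h0
  have hw : r'.weight K = 1 := if_pos rfl
  have hc : r'.cont K = y := if_pos rfl
  rw [hw, hc, one_mul] at h0
  have := sub_nonneg.1 (nonneg_of_mul_nonneg_right h0 (rootChance_pos hK))
  exact (div_le_div_iff_of_pos_right (mass_pos_of_mem_gadgetRoots hK)).1 this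

open Classical in
theorem valueBelow_glue (x : G.Strategy .plus) {k : G.Node} {hk : ¬ G.IsTerminal k.1}
    {y w : G.Strategy .minus} {c : ℝ} {hc : 0 ≤ c} {hw : c * w.reach k.1 = y.reach k.1} :
    G.valueBelow x (y.glue k hk w c hc hw) (G.infosetOf .minus k) =
      c * G.valueBelow x w (G.infosetOf .minus k) := by
  rw [valueBelow, valueBelow, Finset.mul_sum]
  refine Finset.sum_congr rfl fun z hz => ?_
  obtain ⟨hz, hb⟩ := Finset.mem_filter.1 hz
  rw [Strategy.reach_glue_of_isBelow (mem_terminals.1 hz).1 hb]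
  ring

theorem reach_eq_of_infosetOf_eq {i : Player} (y : G.Strategy i) {h k : G.Node}
    (e : G.infosetOf i h = G.infosetOf i k) : y.reach h.1 = y.reach k.1 := by
  rw [Strategy.reach, Strategy.reach, (infosetOf_eq_iff.1 e).2]

open Classical in
/-- After a solve at `I`, the player `minus` can do no better below `K` than before. -/
theorem IsOneKLSS.exists_reply {k : G.Node} (H : IsOneKLSS g n b I s)
    (hk : ¬ G.IsTerminal k.1) (hI : G.infosetOf .plus k = I) (y : G.Strategy .minus) {η : ℝ}
    (hη : 0 < η) : ∃ y' : G.Strategy .minus,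
      (∀ z ∈ G.terminals, ¬ IsBelow (G.infosetOf .minus k) z → y'.reach z = y.reach z) ∧
      G.valueBelow b y' (G.infosetOf .minus k) ≤ G.valueBelow s y (G.infosetOf .minus k) + η := by
  set K := G.infosetOf .minus k with hKdef
  by_cases hK : K ∈ G.gadgetRoots b I
  · rcases (y.reach_nonneg k.1).eq_or_lt with h0 | hpos
    · refine ⟨y, fun _ _ _ => rfl, ?_⟩
      have hz : ∀ x : G.Strategy .plus, G.valueBelow x y K = 0 := fun x =>
        Finset.sum_eq_zero fun z hz => by
          obtain ⟨hz, h, e, hs⟩ := Finset.mem_filter.1 hz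
          rw [y.reach_eq_zero_of_suffix hs (mem_terminals.1 hz).1
            ((reach_eq_of_infosetOf_eq y e).trans h0.symm), mul_zero]
      rw [hz, hz]
      linarith
    -- The equilibrium reply supplies a strategy that reaches `K` with probability 1. Splicing in
    -- `y`, rescaled by `1 / y(K)`, makes `y` comparable with the guarantee at `K`.
    · obtain ⟨r, -, -⟩ := H.2 ⟨K, hK⟩
      have hr : (r.cont K).reach k.1 = 1 := r.cont_reaches K k rfl
      have hinv : (y.reach k.1)⁻¹ * y.reach k.1 = (r.cont K).reach k.1 := by
        rw [hr, inv_mul_cancel₀ hpos.ne']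
      let v := (r.cont K).glue k hk y (y.reach k.1)⁻¹ (inv_nonneg.2 hpos.le) hinv
      have hv : G.Reaches v K := fun h e => by
        rw [reach_eq_of_infosetOf_eq v e, Strategy.reach_glue_of_isBelow k.2
          ⟨k, rfl, List.suffix_rfl⟩, hinv, hr]
      have hle := H.iInf_le_valueBelow hK v hv
      rw [valueBelow_glue] at hle
      have : Nonempty {w : G.Strategy .minus // G.Reaches w K} :=
        ⟨⟨r.cont K, r.cont_reaches K⟩⟩
      -- A near-best continuation against `b`; the error `η / y(K)` becomes `η` once `w` is scaled
      -- back by `y(K)`.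
      obtain ⟨⟨w, hw⟩, hlt⟩ := exists_lt_of_ciInf_lt
        (lt_add_of_pos_right (⨅ w : {w : G.Strategy .minus // G.Reaches w K},
          G.valueBelow b w.1 K) (div_pos hη hpos))
      have hwk : y.reach k.1 * w.reach k.1 = y.reach k.1 := by rw [hw k rfl, mul_one]
      refine ⟨y.glue k hk w (y.reach k.1) hpos.le hwk,
        fun z hz hb => Strategy.reach_glue_of_not_isBelow hz hb, ?_⟩
      rw [valueBelow_glue]
      calc y.reach k.1 * G.valueBelow b w K
          ≤ y.reach k.1 * ((y.reach k.1)⁻¹ * G.valueBelow s y K + η / y.reach k.1) :=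
            mul_le_mul_of_nonneg_left (hlt.le.trans (add_le_add_left hle _)) hpos.le
        _ = G.valueBelow s y K + η := by field_simp
  -- If `K` is not a root, `K ∩ I` is null. Leaves below it have weight zero under both `b` and `s`,
  -- and at the other leaves below `K` the two agree, so `y` itself serves.
  · refine ⟨y, fun _ _ _ => rfl, ?_⟩
    have hnull : ∀ h : G.Node, G.infosetOf .minus h = K → G.infosetOf .plus h = I →
        G.natureReach h.1 * b.reach h.1 = 0 := fun h e e' => by
      have hnn : ∀ h : G.Node, 0 ≤ G.natureReach h.1 * b.reach h.1 := fun h =>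
        mul_nonneg (natureReach_nonneg h.2) (b.reach_nonneg _)
      refine le_antisymm (le_trans ?_ (not_lt.1 fun hlt => hK (mem_gadgetRoots.2 hlt)))
        (hnn h)
      exact Finset.single_le_sum (f := fun h : G.Node => G.natureReach h.1 * b.reach h.1)
        (fun h _ => hnn h) (by simp [e, e'])
    have : G.valueBelow b y K = G.valueBelow s y K := Finset.sum_congr rfl fun z hz => by
      obtain ⟨hz, h, e, hs⟩ := Finset.mem_filter.1 hz
      have hzm := (mem_terminals.1 hz).1
      by_cases hb : IsBelow I z
      · have hl : h.1.length = k.1.length := (infosetOf_eq_iff.1 e).1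
        rw [← hI, isBelow_infosetOf_iff_of_suffix hs hl, hI] at hb
        rcases mul_eq_zero.1 (hnull h e hb) with h0 | h0
        · rw [natureReach_eq_zero_of_suffix hs h0]
          ring
        · rw [b.reach_eq_zero_of_suffix hs hzm h0, s.reach_eq_zero_of_suffix hs hzm]
          subst hb
          rw [H.1.reach_eq, h0]
      · rw [H.1 z hzm hb]
    rw [this]
    exact le_add_of_nonneg_right hη.le

end Margin

/-! ### Nested solves -/

section Nested

variable {g : G.Infoset .plus → Gadget} {n : G.Infoset .plus → Normalization}
  {x x' : G.Strategy .plus} {S : Set (G.Infoset .plus)} {sol : G.Infoset .plus → G.Strategy .plus}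

/-- The strategy followed on arrival depends only on the infoset of `plus`. -/
theorem strategyBefore_congr : ∀ {h h' : List α} (hm : h ∈ G.nodes) (hm' : h' ∈ G.nodes),
    G.infosetOf .plus ⟨h, hm⟩ = G.infosetOf .plus ⟨h', hm'⟩ →
    strategyBefore x S sol h hm = strategyBefore x S sol h' hm'
  | [], [], _, _, _ => rfl
  | [], _ :: _, _, _, e => by simpa using (infosetOf_eq_iff.1 e).1
  | _ :: _, [], _, _, e => by simpa using (infosetOf_eq_iff.1 e).1
  | a :: h, a' :: h', hm, hm', e => by
    have e' := infosetOf_parent_eq hm hm' e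
    rw [strategyBefore, strategyBefore, e',
      strategyBefore_congr (G.parent_mem hm) (G.parent_mem hm') e']

theorem infosetOf_mem_of_cons {a : α} {h : List α}
    (hanc : ∀ I ∈ S, ∀ I' : G.Infoset .plus, IsAncestor I' I → I' ∈ S) (hm : a :: h ∈ G.nodes)
    (hI : G.infosetOf .plus ⟨a :: h, hm⟩ ∈ S) : G.infosetOf .plus ⟨h, G.parent_mem hm⟩ ∈ S :=
  hanc _ hI _ ⟨⟨a :: h, hm⟩, rfl, ⟨h, G.parent_mem hm⟩, rfl, List.suffix_cons _ _⟩

theorem infosetOf_plus_notMem (hind : G.infosetGraph.IsIndepSet S) {h k : G.Node}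
    (e : G.infosetOf .minus h = G.infosetOf .minus k) (hk : G.infosetOf .plus k ∈ S)
    (hne : G.infosetOf .plus h ≠ G.infosetOf .plus k) : G.infosetOf .plus h ∉ S :=
  fun hh => hind hh hk hne ⟨hne, h, k, rfl, rfl, e⟩

/-- If a `minus`-infoset `K` meets an infoset in `S`, then the strategies followed on arrival at
the nodes of `K` agree below `K`. -/
theorem IsNestedOneKLSS.reach_strategyBefore_eq (H : IsNestedOneKLSS g n x S sol x')
    (hind : G.infosetGraph.IsIndepSet S)
    (hanc : ∀ I ∈ S, ∀ I' : G.Infoset .plus, IsAncestor I' I → I' ∈ S)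
    {z : List α} (hz : z ∈ G.nodes) : ∀ {h k : List α} (hm : h ∈ G.nodes) (hk : k ∈ G.nodes),
    G.infosetOf .minus ⟨h, hm⟩ = G.infosetOf .minus ⟨k, hk⟩ → G.infosetOf .plus ⟨k, hk⟩ ∈ S →
    h <:+ z → (strategyBefore x S sol h hm).reach z = (strategyBefore x S sol k hk).reach z
  | [], [], _, _, _, _, _ => rfl
  | [], _ :: _, _, _, e, _, _ => by simpa using (infosetOf_eq_iff.1 e).1
  | _ :: _, [], _, _, e, _, _ => by simpa using (infosetOf_eq_iff.1 e).1
  | a :: h, b :: k, hm, hk, e, hS, hs => by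
    have e' := infosetOf_parent_eq hm hk e
    have hS' := infosetOf_mem_of_cons hanc hk hS
    have hs' := (List.suffix_cons a h).trans hs
    rw [strategyBefore, strategyBefore, if_pos hS']
    by_cases hne : G.infosetOf .plus ⟨h, G.parent_mem hm⟩ = G.infosetOf .plus ⟨k, G.parent_mem hk⟩
    · rw [hne, if_pos hS']
    -- No solve takes place at `h`, by independence, and the solve at the infoset of `k` leaves `z`
    -- alone, since `z` passes through a different infoset at that depth. Ancestor-closure lets the
    -- argument continue towards the root.
    · rw [if_neg (infosetOf_plus_notMem hind e' hS' hne),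
        (H.solve ⟨k, G.parent_mem hk⟩ hS').1 z hz]
      · exact H.reach_strategyBefore_eq hind hanc hz _ _ e' hS' hs'
      · rwa [isBelow_infosetOf_iff_of_suffix (h := ⟨h, G.parent_mem hm⟩) hs'
          (infosetOf_eq_iff.1 e').1]

theorem IsNestedOneKLSS.reach_strategyAt_eq (H : IsNestedOneKLSS g n x S sol x')
    (hind : G.infosetGraph.IsIndepSet S)
    (hanc : ∀ I ∈ S, ∀ I' : G.Infoset .plus, IsAncestor I' I → I' ∈ S)
    {z : List α} (hz : z ∈ G.nodes) {h k : G.Node}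
    (e : G.infosetOf .minus h = G.infosetOf .minus k) (hk : G.infosetOf .plus k ∈ S)
    (hs : h.1 <:+ z) : (strategyAt x S sol h).reach z = (sol (G.infosetOf .plus k)).reach z := by
  rw [strategyAt]
  by_cases hne : G.infosetOf .plus h = G.infosetOf .plus k
  · rw [hne, if_pos hk]
  · rw [if_neg (infosetOf_plus_notMem hind e hk hne), (H.solve k hk).1 z hz]
    · exact H.reach_strategyBefore_eq hind hanc hz _ _ e hk hs
    · rwa [isBelow_infosetOf_iff_of_suffix hs (infosetOf_eq_iff.1 e).1]

theorem IsNestedOneKLSS.reach_eq (H : IsNestedOneKLSS g n x S sol x') (h : G.Node) :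
    x'.reach h.1 = (strategyBefore x S sol h.1 h.2).reach h.1 := by
  rw [H.play h, strategyAt]
  split_ifs with hS
  · exact (H.solve h hS).1.reach_eq
  · rfl

open Classical in
/-- Below `K`, the solves at the depth of `K` do not help `minus`. -/
theorem IsNestedOneKLSS.dominates_of_below (H : IsNestedOneKLSS g n x S sol x')
    (hind : G.infosetGraph.IsIndepSet S)
    (hanc : ∀ I ∈ S, ∀ I' : G.Infoset .plus, IsAncestor I' I → I' ∈ S) {k : G.Node}
    (hk : ¬ G.IsTerminal k.1) {X X' : List α → ℝ}
    (hX : ∀ z ∈ G.terminals, ¬ IsBelow (G.infosetOf .minus k) z → X' z = X z)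
    (hb : ∀ z ∈ G.terminals, ∀ h : G.Node, G.infosetOf .minus h = G.infosetOf .minus k →
      h.1 <:+ z → X z = (strategyBefore x S sol h.1 h.2).reach z)
    (ha : ∀ z ∈ G.terminals, ∀ h : G.Node, G.infosetOf .minus h = G.infosetOf .minus k →
      h.1 <:+ z → X' z = (strategyAt x S sol h).reach z) :
    G.Dominates X' X := by
  by_cases hS : ∃ k' : G.Node, G.infosetOf .minus k' = G.infosetOf .minus k ∧
      G.infosetOf .plus k' ∈ S
  · obtain ⟨k', e, hS⟩ := hS
    have hk' : ¬ G.IsTerminal k'.1 := fun ht => by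
      obtain ⟨hl, hs⟩ := infosetOf_eq_iff.1 e
      have := past_eq_of_seq_eq hl hs
      rw [seq_of_isTerminal ht, seq_of_not_isTerminal hk, this] at hs
      simp at hs
    refine .of_below hX fun y η hη => ?_
    obtain ⟨y', hy, hle⟩ := (H.solve k' hS).exists_reply hk' rfl y hη
    rw [e] at hy hle
    refine ⟨y', hy, ?_⟩
    convert hle using 1
    · refine Finset.sum_congr rfl fun z hz => ?_
      obtain ⟨hz, h, e', hs⟩ := Finset.mem_filter.1 hz
      rw [hb z hz h e' hs, H.reach_strategyBefore_eq hind hanc (mem_terminals.1 hz).1 h.2 k'.2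
        (e'.trans e.symm) hS hs]
    · refine congrArg (· + η) (Finset.sum_congr rfl fun z hz => ?_)
      obtain ⟨hz, h, e', hs⟩ := Finset.mem_filter.1 hz
      rw [ha z hz h e' hs, H.reach_strategyAt_eq hind hanc (mem_terminals.1 hz).1
        (e'.trans e.symm) hS hs]
  · refine .of_eqOn fun z hz => ?_
    by_cases hbel : IsBelow (G.infosetOf .minus k) z
    · obtain ⟨h, e, hs⟩ := hbel
      rw [hb z hz h e hs, ha z hz h e hs, strategyAt, if_neg fun hh => hS ⟨h, e, hh⟩]
    · exact hX z hz hbel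

open Classical in
/-- The weight of `z` for the strategy in which only the solves at depth less than `t` are
performed. -/
noncomputable def stage (x : G.Strategy .plus) (S : Set (G.Infoset .plus))
    (sol : G.Infoset .plus → G.Strategy .plus) (t : ℕ) (z : List α) : ℝ :=
  -- The dropped list is the ancestor of `z` at depth `min t z.length`; truncated subtraction makes
  -- it `z` itself when `t` is large. For nodes `z` the value 0 never occurs.
  if hz : z.drop (z.length - t) ∈ G.nodes then (strategyBefore x S sol _ hz).reach z else 0

theorem stage_eq {t : ℕ} {z h : List α} (hm : h ∈ G.nodes) (hs : h <:+ z)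
    (hl : h.length = min t z.length) :
    stage x S sol t z = (strategyBefore x S sol h hm).reach z := by
  have : z.drop (z.length - t) = h :=
    (List.drop_suffix _ _).eq_of_isSuffix_of_length_eq hs (by rw [List.length_drop]; omega)
  subst this
  exact dif_pos hm

theorem stage_succ_eq {t : ℕ} {z : List α} (hz : z ∈ G.nodes) (h : G.Node) (hs : h.1 <:+ z)
    (hl : h.1.length = t) (hlt : t < z.length) :
    stage x S sol (t + 1) z = (strategyAt x S sol h).reach z := by
  obtain ⟨l, hl'⟩ := hs
  obtain ⟨l', a, rfl⟩ : ∃ l' a, l = l' ++ [a] := by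
    rcases List.eq_nil_or_concat l with rfl | ⟨l', a, rfl⟩
    · have := congrArg List.length hl'
      simp at this
      omega
    · exact ⟨l', a, by simp⟩
  have hs' : a :: h.1 <:+ z := ⟨l', by simpa using hl'⟩
  have hm : a :: h.1 ∈ G.nodes := mem_of_suffix hs' hz
  rw [stage_eq hm hs' (by simp; omega), strategyAt, strategyBefore]

theorem exists_suffix_of_length {t : ℕ} {z : List α} (hz : z ∈ G.nodes) (ht : t ≤ z.length) :
    ∃ h : G.Node, h.1 <:+ z ∧ h.1.length = t :=
  ⟨⟨_, mem_of_suffix (List.drop_suffix (z.length - t) z) hz⟩, List.drop_suffix _ _, by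
    rw [List.length_drop]; omega⟩

open Classical in
theorem IsNestedOneKLSS.dominates_stage_succ (H : IsNestedOneKLSS g n x S sol x')
    (hind : G.infosetGraph.IsIndepSet S)
    (hanc : ∀ I ∈ S, ∀ I' : G.Infoset .plus, IsAncestor I' I → I' ∈ S) (t : ℕ) :
    G.Dominates (stage x S sol (t + 1)) (stage x S sol t) := by
  -- The solves at depth `t` are switched on only below the infosets in `T`. Such a hybrid need not
  -- come from a strategy of `plus`, which is why `Dominates` speaks of weights on leaves.
  have key : ∀ T : Finset (G.Infoset .minus),
      (∀ K ∈ T, ∃ k : G.Node, ¬ G.IsTerminal k.1 ∧ k.1.length = t ∧ G.infosetOf .minus k = K) →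
      G.Dominates (fun z => if ∃ K ∈ T, IsBelow K z then stage x S sol (t + 1) z
        else stage x S sol t z) (stage x S sol t) := by
    intro T
    induction T using Finset.induction_on with
    | empty => exact fun _ => .of_eqOn fun z _ => by simp
    | insert K T hKT ih =>
      intro hT
      refine Dominates.trans ?_ (ih fun K' hK' => hT K' (Finset.mem_insert_of_mem hK'))
      obtain ⟨k, hk, hkt, rfl⟩ := hT K (Finset.mem_insert_self K T)
      have hlt : ∀ z ∈ G.terminals, ∀ h : G.Node, G.infosetOf .minus h = G.infosetOf .minus k →
          h.1 <:+ z → h.1.length = t ∧ t < z.length := by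
        intro z hz h e hs
        obtain ⟨hl, hseq⟩ := infosetOf_eq_iff.1 e
        refine ⟨hl.trans hkt, lt_of_le_of_ne ((hl.trans hkt) ▸ hs.length_le) fun hle => ?_⟩
        have hhz : h.1 = z := hs.eq_of_length (by omega)
        have := past_eq_of_seq_eq hl hseq
        rw [hhz] at this hseq
        rw [seq_of_isTerminal (mem_terminals.1 hz).2, seq_of_not_isTerminal hk, this] at hseq
        simp at hseq
      refine H.dominates_of_below hind hanc hk (fun z _ hz => by simp [hz])
        (fun z hz h e hs => ?_) (fun z hz h e hs => ?_)
      · obtain ⟨h1, h2⟩ := hlt z hz h e hs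
        rw [if_neg, stage_eq h.2 hs (by omega)]
        rintro ⟨K', hK', hb⟩
        obtain ⟨k', -, hkt', rfl⟩ := hT K' (Finset.mem_insert_of_mem hK')
        rw [isBelow_infosetOf_iff_of_suffix hs (h1.trans hkt'.symm), e] at hb
        exact hKT (hb ▸ hK')
      · obtain ⟨h1, h2⟩ := hlt z hz h e hs
        rw [if_pos ⟨_, Finset.mem_insert_self _ _, h, e, hs⟩,
          stage_succ_eq (mem_terminals.1 hz).1 h hs h1 h2]
  -- With all internal infosets of depth `t` in `T`, every leaf deeper than `t` is covered; at the
  -- remaining leaves the two stages coincide.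
  refine Dominates.trans (.of_eqOn fun z hz => ?_) (key (Finset.univ.filter fun K =>
    ∃ k : G.Node, ¬ G.IsTerminal k.1 ∧ k.1.length = t ∧ G.infosetOf .minus k = K)
    fun K hK => (Finset.mem_filter.1 hK).2)
  have hzm := (mem_terminals.1 hz).1
  split_ifs with hb
  · rfl
  · rcases lt_or_ge t z.length with hlt | hge
    · obtain ⟨h, hs, hl⟩ := exists_suffix_of_length hzm hlt.le
      exact absurd ⟨_, Finset.mem_filter.2 ⟨Finset.mem_univ _, h,
        not_isTerminal_of_suffix hs hzm (hl ▸ hlt), hl, rfl⟩, h, rfl, hs⟩ hb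
    · rw [stage_eq hzm List.suffix_rfl (by omega), stage_eq hzm List.suffix_rfl (by omega)]

theorem stage_zero {z : List α} : stage x S sol 0 z = x.reach z :=
  stage_eq G.root_mem List.nil_suffix (by simp)

/-- Nested solves do not help `minus`. -/
theorem IsNestedOneKLSS.dominates (H : IsNestedOneKLSS g n x S sol x')
    (hind : G.infosetGraph.IsIndepSet S)
    (hanc : ∀ I ∈ S, ∀ I' : G.Infoset .plus, IsAncestor I' I → I' ∈ S) :
    G.Dominates x'.reach x.reach := by
  have key : ∀ t, G.Dominates (stage x S sol t) x.reach := fun t => by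
    induction t with
    | zero => exact .of_eqOn fun z _ => stage_zero
    | succ t ih => exact (H.dominates_stage_succ hind hanc t).trans ih
  -- At the maximal depth the stage uses the strategy on arrival at `z`. A solve at the infoset of
  -- `z` itself does not change the reach of `z`, so this is `x'`.
  refine Dominates.trans (.of_eqOn fun z hz => ?_) (key (G.nodes.sup List.length))
  have hzm := (mem_terminals.1 hz).1
  have := Finset.le_sup (f := List.length) hzm
  rw [stage_eq hzm List.suffix_rfl (by omega)]
  exact H.reach_eq ⟨z, hzm⟩

end Nested

/-! ### From domination to equilibrium. -/

theorem Dominates.bestResponseValue_le {x x' : G.Strategy .plus}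
    (H : G.Dominates x'.reach x.reach) : G.bestResponseValue x ≤ G.bestResponseValue x' := by
  unfold bestResponseValue
  rcases isEmpty_or_nonempty (G.Strategy .minus) with _ | _
  · simp
  · refine le_ciInf fun y => le_of_forall_pos_le_add fun η hη => ?_
    obtain ⟨y', hy'⟩ := H y η hη
    exact (ciInf_le (payoff_bddBelow x) y').trans hy'

/-- Each of the two inequalities passes through `u(x, y)` and spends one `δ` on the optimality of
`x` and one on that of `y`. -/
theorem Dominates.isEpsNash {x x' : G.Strategy .plus} (H : G.Dominates x'.reach x.reach)
    {δ : ℝ} {y : G.Strategy .minus} (hxy : G.IsEpsNash δ x y) : G.IsEpsNash (2 * δ) x' y := by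
  refine ⟨fun w => le_of_forall_pos_le_add fun η hη => ?_,
    fun w => le_of_forall_pos_le_add fun η hη => ?_⟩
  · obtain ⟨v, hv⟩ := H y η hη
    change G.payoff x v ≤ G.payoff x' y + η at hv
    linarith [hxy.1 w, hxy.2 v]
  · obtain ⟨v, hv⟩ := H w η hη
    change G.payoff x v ≤ G.payoff x' w + η at hv
    linarith [hxy.1 x', hxy.2 v]

end Game

theorem mainTheorem2 {α Ω : Type*} (G : Game α Ω) (ε : ℝ) (x : G.Strategy .plus)
    (hx : G.IsEpsNEStrategy ε x)
    (S : Set (G.Infoset .plus)) (hind : G.infosetGraph.IsIndepSet S)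
    (hanc : ∀ I ∈ S, ∀ I' : G.Infoset .plus, Game.IsAncestor I' I → I' ∈ S)
    (g : G.Infoset .plus → Game.Gadget) (n : G.Infoset .plus → Game.Normalization)
    (sol : G.Infoset .plus → G.Strategy .plus) (x' : G.Strategy .plus)
    (hx' : Game.IsNestedOneKLSS g n x S sol x') :
    G.IsEpsNEStrategy ε x' ∧
      ∀ (δ : ℝ) (y : G.Strategy .minus), G.IsEpsNash δ x y → G.IsEpsNash (2 * δ) x' y := by
  have H := hx'.dominates hind hanc
  exact ⟨fun w => (hx w).trans H.bestResponseValue_le, fun _ _ hxy => H.isEpsNash hxy⟩
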